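/- Let $A,B,C,D,p_0,q_0\in\mathbb R$ with $B\neq 0$, let $\Lambda_S=\begin{bmatrix}A&B&:&p_0\\ C&D&:&q_0\end{bmatrix}$, and put $K_B=1/\sqrt{2\pi B}$ (principal square root if $B<0$). The special affine Fourier transform of $f$ is $$\widehat f_{\Lambda_S}(\omega)=K_B\int_{\mathbb R} f(x)\,\exp\Big\{\frac{i}{2B}\big(Ax^2+2x(p_0-\omega)-2\omega(Dp_0-Bq_0)+D\omega^2\big)\Big\}\,dx ,$$ where for $f\in L^2(\mathbb R)$ the integral is understood as the limit in $L^2(\mathbb R)$, as $R\to\infty$, of the integrals over $[-R,R]$ (this limit exists). **Theorem 4.1.** For every complex-valued $f\in L^2(\mathbb R)$ and every real $p$ with $1\le p\le 2$, $$\left(\int_{\mathbb R}|x|^p|f(x)|^p\,dx\right)^{1/p}\left(\int_{\mathbb R}|\omega|^p\,\big|\widehat f_{\Lambda_S}(\omega)\big|^p\,d\omega\right)^{1/p}\;\ge\;\frac{|B|^{(p+2)/(2p)}}{2}\,\|f\|_2^2 ,$$ where the integrals on the left may take the value $+\infty$ and $0\cdot\infty=0$. -/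

import Mathlib

open MeasureTheory Filter
open scoped ENNReal Topology FourierTransform

/-- The augmented special affine parameter matrix `[A B : p; C D : q]`. -/
structure AugmentedMatrix where
  A : ℝ
  B : ℝ
  C : ℝ
  D : ℝ
  p : ℝ
  q : ℝ

/-- The normalising constant `K_B = 1 / √(2 π B)`, with the principal square root when `B < 0`. -/
noncomputable def saftConst (Λ : AugmentedMatrix) : ℂ :=
  1 / ((2 * Real.pi * Λ.B : ℝ) : ℂ) ^ (1 / 2 : ℂ)

/-- The kernel of the special affine Fourier transform. -/
noncomputable def saftKernel (Λ : AugmentedMatrix) (x ω : ℝ) : ℂ :=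
  saftConst Λ * Complex.exp (Complex.I / (2 * (Λ.B : ℂ)) *
    ((Λ.A * x ^ 2 + 2 * x * (Λ.p - ω) - 2 * ω * (Λ.D * Λ.p - Λ.B * Λ.q) + Λ.D * ω ^ 2 : ℝ) : ℂ))

/-- The special affine Fourier integral, meaningful when `f` is integrable. -/
noncomputable def saftIntegral (Λ : AugmentedMatrix) (f : ℝ → ℂ) (ω : ℝ) : ℂ :=
  ∫ x : ℝ, f x * saftKernel Λ x ω

/-- `F` is the special affine Fourier transform of `f ∈ L²(ℝ)`: the limit in `L²(ℝ)`, as `R → ∞`, of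
the special affine Fourier integrals of the (integrable) truncations of `f` to `[-R, R]`. -/
def IsSAFT (Λ : AugmentedMatrix) (f F : Lp ℂ 2 (volume : Measure ℝ)) : Prop :=
  Tendsto (fun R : ℝ =>
    eLpNorm (fun ω => saftIntegral Λ ((Set.Icc (-R) R).indicator f) ω - F ω) 2 volume)
    atTop (𝓝 0)

theorem saft_aux_fourier_ae (g : ℝ → ℂ) (hg : MemLp g 2 volume) (hgi : Integrable g volume) :
    ((𝓕 (hg.toLp g) : Lp ℂ 2 (volume : Measure ℝ)) : ℝ → ℂ) =ᵐ[volume] 𝓕 g := by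
  have hcont : Continuous (𝓕 g) :=
    VectorFourier.fourierIntegral_continuous Real.continuous_fourierChar
      (by exact continuous_inner) hgi
  refine ae_eq_of_integral_contDiff_smul_eq ?_ hcont.locallyIntegrable ?_
  · exact (Lp.memLp _).locallyIntegrable (by norm_num)
  intro φ hφ hφc
  have h₂ : HasCompactSupport (fun x => (φ x : ℂ)) := hφc.comp_left (g := Complex.ofReal) rfl
  let ψ : SchwartzMap ℝ ℂ := h₂.toSchwartzMap (Complex.ofRealCLM.contDiff.comp hφ)
  have hψ : ∀ x, ψ x = (φ x : ℂ) := fun x => rfl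
  have key := congrArg (fun T => T ψ) (Lp.fourier_toTemperedDistribution_eq (hg.toLp g))
  simp only [TemperedDistribution.fourier_apply, Lp.toTemperedDistribution_apply, hψ] at key
  have e1 : ∫ x, φ x • ((𝓕 (hg.toLp g) : Lp ℂ 2 (volume : Measure ℝ)) : ℝ → ℂ) x
      = ∫ x, (φ x : ℂ) • ((𝓕 (hg.toLp g) : Lp ℂ 2 (volume : Measure ℝ)) : ℝ → ℂ) x := by
    simp
  rw [e1, ← key]
  have e2 : ∫ x, (𝓕 ψ) x • (hg.toLp g : ℝ → ℂ) x = ∫ x, (𝓕 ψ) x • g x := by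
    apply integral_congr_ae
    filter_upwards [hg.coeFn_toLp] with x hx
    rw [hx]
  rw [e2]
  have e3 := VectorFourier.integral_fourierIntegral_smul_eq_flip (μ := volume) (ν := volume)
    (L := innerₗ ℝ) (f := ψ) (g := g) Real.continuous_fourierChar
    (by exact continuous_inner) ψ.integrable hgi
  rw [flip_innerₗ] at e3
  have e4 : ∀ x, φ x • (𝓕 g) x = ψ x • (𝓕 g) x := fun x => by simp [hψ]
  simp_rw [e4]
  exact e3

theorem saft_aux_dilate (a : ℝ) (ha : a ≠ 0) (h : ℝ → ℂ) :
    eLpNorm (fun ω => h (a * ω)) 2 volume ≤ (ENNReal.ofReal |a⁻¹|) ^ (1 / 2 : ℝ) *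
      eLpNorm h 2 volume := by
  have hemb : MeasurableEmbedding (fun ω : ℝ => a * ω) :=
    (Homeomorph.mulLeft₀ a ha).measurableEmbedding
  have := hemb.eLpNorm_map_measure (g := h) (p := 2) (μ := volume)
  rw [Real.map_volume_mul_left ha] at this
  rw [show (fun ω => h (a * ω)) = h ∘ (fun ω => a * ω) from rfl, ← this,
    eLpNorm_smul_measure_of_ne_top (by norm_num)]
  simp

theorem saft_aux_trunc (g : ℝ → ℂ) (hg : MemLp g 2 volume) :
    Tendsto (fun R : ℝ => eLpNorm ((Set.Icc (-R) R).indicator g - g) 2 volume) atTop (𝓝 0) := by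
  have hfin : ∫⁻ x, ‖g x‖ₑ ^ (2 : ℝ) < ∞ := by
    have := lintegral_rpow_enorm_lt_top_of_eLpNorm_lt_top (p := 2) (by norm_num) (by norm_num)
      hg.eLpNorm_lt_top
    simpa using this
  have hlim : Tendsto (fun R : ℝ => ∫⁻ x, ‖((Set.Icc (-R) R).indicator g - g) x‖ₑ ^ (2 : ℝ))
      atTop (𝓝 (∫⁻ _ : ℝ, 0)) := by
    refine tendsto_lintegral_filter_of_dominated_convergence' (fun x => ‖g x‖ₑ ^ (2 : ℝ)) ?_ ?_
      hfin.ne ?_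
    · refine Eventually.of_forall fun R => ?_
      exact ((hg.1.indicator measurableSet_Icc).sub hg.1).enorm.pow_const _
    · refine Eventually.of_forall fun R => Eventually.of_forall fun x => ?_
      refine ENNReal.rpow_le_rpow ?_ (by norm_num)
      by_cases hx : x ∈ Set.Icc (-R) R <;> simp [hx]
    · refine Eventually.of_forall fun x => ?_
      refine tendsto_const_nhds.congr' ?_
      filter_upwards [eventually_ge_atTop |x|] with R hR
      have hx : x ∈ Set.Icc (-R) R := abs_le.mp hR
      simp [Set.indicator_of_mem hx]
  have h2 := ((ENNReal.continuous_rpow_const (y := 1 / 2)).tendsto _).comp hlim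
  simp only [lintegral_zero] at h2
  rw [ENNReal.zero_rpow_of_pos (by norm_num)] at h2
  refine h2.congr fun R => ?_
  rw [eLpNorm_eq_lintegral_rpow_enorm_toReal (by norm_num) (by norm_num)]
  simp

theorem exists_isSAFT (Λ : AugmentedMatrix) (f : Lp ℂ 2 (volume : Measure ℝ)) :
    ∃ F : Lp ℂ 2 (volume : Measure ℝ), IsSAFT Λ f F := by
  by_cases hB : Λ.B = 0
  · refine ⟨0, ?_⟩
    have h0 : saftConst Λ = 0 := by simp [saftConst, hB]
    have : ∀ R : ℝ, eLpNorm (fun ω => saftIntegral Λ ((Set.Icc (-R) R).indicator f) ω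
        - (0 : Lp ℂ 2 (volume : Measure ℝ)) ω) 2 volume = 0 := by
      intro R
      rw [← eLpNorm_zero (p := 2) (μ := (volume : Measure ℝ)) (ε := ℂ) (α := ℝ)]
      apply eLpNorm_congr_ae
      refine Eventually.of_forall fun ω => ?_
      simp [saftIntegral, saftKernel, h0]
    unfold IsSAFT
    simp only [this]
    exact tendsto_const_nhds
  have hBC : (Λ.B : ℂ) ≠ 0 := by exact_mod_cast hB
  have hpi : (Real.pi : ℂ) ≠ 0 := by exact_mod_cast Real.pi_ne_zero
  let c : ℝ → ℂ := fun x => Complex.exp (Complex.I / (2 * (Λ.B : ℂ)) *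
    ((Λ.A * x ^ 2 + 2 * x * Λ.p : ℝ) : ℂ))
  let U : ℝ → ℂ := fun ω => saftConst Λ * Complex.exp (Complex.I / (2 * (Λ.B : ℂ)) *
    ((- 2 * ω * (Λ.D * Λ.p - Λ.B * Λ.q) + Λ.D * ω ^ 2 : ℝ) : ℂ))
  let a : ℝ := 1 / (2 * Real.pi * Λ.B)
  have ha : a ≠ 0 := by simp [a, hB, Real.pi_ne_zero]
  have hunit : ∀ r : ℝ, ‖Complex.exp (Complex.I / (2 * (Λ.B : ℂ)) * (r : ℂ))‖ = 1 := by
    intro r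
    rw [show Complex.I / (2 * (Λ.B : ℂ)) * (r : ℂ) = ((r / (2 * Λ.B) : ℝ) : ℂ) * Complex.I by
      push_cast; ring]
    exact Complex.norm_exp_ofReal_mul_I _
  have hUn : ∀ ω, ‖U ω‖ = ‖saftConst Λ‖ := fun ω => by simp only [U, norm_mul, hunit, mul_one]
  have hUc : Continuous U := by fun_prop
  have hcc : Continuous c := by fun_prop
  have hg : MemLp (fun x => c x * f x) 2 volume := by
    refine (Lp.memLp f).of_le (hcc.aestronglyMeasurable.mul (Lp.memLp f).1)
      (Eventually.of_forall fun x => ?_)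
    simp only [norm_mul, c, hunit, one_mul, le_refl]
  set g : ℝ → ℂ := fun x => c x * f x with hgdef
  let G : Lp ℂ 2 (volume : Measure ℝ) := 𝓕 (hg.toLp g)
  have hbound : ∀ h : ℝ → ℂ, eLpNorm (fun ω => U ω * h (a * ω)) 2 volume ≤
      ENNReal.ofReal ‖saftConst Λ‖ * ((ENNReal.ofReal |a⁻¹|) ^ (1 / 2 : ℝ) *
        eLpNorm h 2 volume) := by
    intro h
    refine (eLpNorm_le_mul_eLpNorm_of_ae_le_mul (g := fun ω => h (a * ω)) (c := ‖saftConst Λ‖)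
      (Eventually.of_forall fun ω => ?_) 2).trans ?_
    · rw [norm_mul, hUn]
    · gcongr
      exact saft_aux_dilate a ha h
  have hCtop : ENNReal.ofReal ‖saftConst Λ‖ * (ENNReal.ofReal |a⁻¹|) ^ (1 / 2 : ℝ) ≠ ∞ :=
    ENNReal.mul_ne_top ENNReal.ofReal_ne_top
      (ENNReal.rpow_ne_top_of_nonneg (by norm_num) ENNReal.ofReal_ne_top)
  have hqmp : Measure.QuasiMeasurePreserving (fun ω : ℝ => a * ω) volume volume := by
    refine ⟨by fun_prop, ?_⟩
    rw [Real.map_volume_mul_left ha]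
    exact Measure.smul_absolutelyContinuous
  have hF : MemLp (fun ω => U ω * G (a * ω)) 2 volume := by
    refine ⟨hUc.aestronglyMeasurable.mul
      ((Lp.memLp G).1.comp_quasiMeasurePreserving hqmp), ?_⟩
    refine (hbound G).trans_lt ?_
    rw [← mul_assoc]
    exact ENNReal.mul_lt_top hCtop.lt_top (Lp.memLp G).2
  refine ⟨hF.toLp _, ?_⟩
  have hint : ∀ R ω, saftIntegral Λ ((Set.Icc (-R) R).indicator f) ω =
      U ω * 𝓕 ((Set.Icc (-R) R).indicator g) (a * ω) := by
    intro R ω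
    rw [Real.fourier_real_eq_integral_exp_smul, saftIntegral, ← integral_const_mul]
    congr 1
    ext x
    by_cases hx : x ∈ Set.Icc (-R) R
    · have hexp : Complex.exp (Complex.I / (2 * (Λ.B : ℂ)) *
          ((Λ.A * x ^ 2 + 2 * x * (Λ.p - ω) - 2 * ω * (Λ.D * Λ.p - Λ.B * Λ.q)
            + Λ.D * ω ^ 2 : ℝ) : ℂ)) =
          Complex.exp (Complex.I / (2 * (Λ.B : ℂ)) *
            ((- 2 * ω * (Λ.D * Λ.p - Λ.B * Λ.q) + Λ.D * ω ^ 2 : ℝ) : ℂ)) *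
          (Complex.exp (((-2 * Real.pi * x * (a * ω) : ℝ) : ℂ) * Complex.I) * c x) := by
        simp only [c, a]
        rw [← Complex.exp_add, ← Complex.exp_add]
        congr 1
        push_cast
        field_simp
        ring
      simp only [Set.indicator_of_mem hx, saftKernel, hexp, U, hgdef, smul_eq_mul]
      ring
    · simp [Set.indicator_of_notMem hx]
  have htr := saft_aux_trunc g hg
  have hle : ∀ R : ℝ, eLpNorm (fun ω => saftIntegral Λ ((Set.Icc (-R) R).indicator f) ω
      - (hF.toLp _ : Lp ℂ 2 (volume : Measure ℝ)) ω) 2 volume ≤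
      ENNReal.ofReal ‖saftConst Λ‖ * (ENNReal.ofReal |a⁻¹|) ^ (1 / 2 : ℝ) *
        eLpNorm ((Set.Icc (-R) R).indicator g - g) 2 volume := by
    intro R
    have hgR : MemLp ((Set.Icc (-R) R).indicator g) 2 volume := hg.indicator measurableSet_Icc
    have hgRi : Integrable ((Set.Icc (-R) R).indicator g) volume := by
      rw [integrable_indicator_iff measurableSet_Icc]
      have : MemLp g 2 (volume.restrict (Set.Icc (-R) R)) := hg.restrict _
      exact this.integrable (by norm_num)
    have hP : eLpNorm (fun ω => 𝓕 ((Set.Icc (-R) R).indicator g) ω - G ω) 2 volume =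
        eLpNorm ((Set.Icc (-R) R).indicator g - g) 2 volume := by
      have h1 : (fun ω => 𝓕 ((Set.Icc (-R) R).indicator g) ω - G ω) =ᵐ[volume]
          ((𝓕 (hgR.toLp _ - hg.toLp g) : Lp ℂ 2 (volume : Measure ℝ)) : ℝ → ℂ) := by
        have hsub : (𝓕 (hgR.toLp _ - hg.toLp g) : Lp ℂ 2 (volume : Measure ℝ)) =
            𝓕 (hgR.toLp _) - G := (Lp.fourierTransformₗᵢ ℝ ℂ).map_sub _ _
        rw [hsub]
        filter_upwards [Lp.coeFn_sub (𝓕 (hgR.toLp _) : Lp ℂ 2 (volume : Measure ℝ)) G,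
          saft_aux_fourier_ae _ hgR hgRi] with x hx hx'
        rw [hx, Pi.sub_apply, hx']
      have h2 : (Set.Icc (-R) R).indicator g - g =ᵐ[volume]
          ((hgR.toLp _ - hg.toLp g : Lp ℂ 2 (volume : Measure ℝ)) : ℝ → ℂ) := by
        rw [← MemLp.toLp_sub]
        exact (MemLp.coeFn_toLp _).symm
      rw [eLpNorm_congr_ae h1, eLpNorm_congr_ae h2, ← Lp.enorm_def, ← Lp.enorm_def]
      rw [← ofReal_norm, ← ofReal_norm, Lp.norm_fourier_eq]
    rw [← hP, mul_assoc]
    refine le_trans (le_of_eq ?_) (hbound (fun ω =>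
      𝓕 ((Set.Icc (-R) R).indicator g) ω - G ω))
    apply eLpNorm_congr_ae
    filter_upwards [hF.coeFn_toLp] with ω hω
    rw [hω, hint, mul_sub]
  refine tendsto_of_tendsto_of_tendsto_of_le_of_le tendsto_const_nhds ?_
    (fun _ => zero_le) hle
  have := ENNReal.Tendsto.const_mul htr (Or.inr hCtop)
  simpa using this

/-- The special affine Fourier transform on `L²(ℝ)`; the value is determined by `IsSAFT` because
limits in `L²(ℝ)` are unique. -/
noncomputable def saft (Λ : AugmentedMatrix) (f : Lp ℂ 2 (volume : Measure ℝ)) :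
    Lp ℂ 2 (volume : Measure ℝ) :=
  (exists_isSAFT Λ f).choose

/-!
The inequality is a form of Heisenberg's uncertainty principle in which the pair `(Lᵖ, Lᵖ)` replaces
`(L², L²)`. Put `g = c f` with the unimodular chirp `c x = exp (i (A x² + 2 p₀ x) / (2 B))`. Up to a
unimodular factor, the special affine Fourier transform of `f` is `(2π|B|)^(-1/2) 𝓕 g (ω / (2π B))`
(`AugmentedMatrix.saftIntegral_eq`), so the claim follows by scaling from

  `‖g‖₂² ≤ 4π ‖x g‖_p ‖ξ 𝓕 g‖_p`   (`eLpNorm_sq_le_mul_fourier`)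

and `2π ≤ (2π)^(1/2 + 1/p)`, which is where `p ≤ 2` enters a second time.

Formally, the displayed inequality is `‖g‖₂² = -2 Re ⟨x g, g'⟩` combined with the bilinear
Hausdorff–Young inequality `|∫ 𝓕 u · v| ≤ ‖u‖_p ‖v‖_p` (`enorm_integral_fourier_mul_le`). To avoid
regularity questions, `g'` is replaced by the symmetric difference `(g (x + h) - g (x - h)) / (2 h)`,
whose Fourier transform is at most `2π |ξ| |𝓕 g|` in modulus, and `x` by its truncation to
`[-1/h, 1/h]`; a shift of the integration variable then replaces the integration by parts
(`re_integral_mul_conj_difference`), and `h → 0` gives the result.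

The Hausdorff–Young inequality interpolates between the trivial bound for `p = 1` and Plancherel's
theorem for `p = 2`. On simple functions the form is a finite sum, and Hadamard's three lines theorem
applies to an entire function of the interpolation parameter (`norm_bilinear_sum_le_rpow`); density
gives the general case (`enorm_bilinear_le_eLpNorm_mul_eLpNorm`).

If `f ∈ L²` and the first factor on the right is finite, then `f` is integrable
(`integrable_of_memLp_two_of_memLp_mul`), so that its transform is given by the integral itself. The
convention `0 · ∞ = 0` is harmless, because the transform is injective.
-/

/-! ### Interpolation of bilinear forms on finite sums -/

/-- The analytic family `z ↦ sgn a · |a| ^ (p (1 - z / 2))` of complex interpolation. It has modulus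
`|a| ^ p` on `Re z = 0`, modulus `|a| ^ (p / 2)` on `Re z = 1`, and the value `a` at
`z = 2 - 2 / p`. The value at `a = 0` is set to `0`. -/
noncomputable def interpPath (p : ℝ) (z a : ℂ) : ℂ :=
  if a = 0 then 0 else a / ‖a‖ * (‖a‖ : ℂ) ^ ((p : ℂ) * (1 - z / 2))

theorem interpPath_zero (p : ℝ) (z : ℂ) : interpPath p z 0 = 0 := by simp [interpPath]

theorem norm_interpPath {p : ℝ} {z : ℂ} (h : p * (1 - z.re / 2) ≠ 0) (a : ℂ) :
    ‖interpPath p z a‖ = ‖a‖ ^ (p * (1 - z.re / 2)) := by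
  by_cases ha : a = 0
  · simp [interpPath, ha, Real.zero_rpow h]
  · have hn : 0 < ‖a‖ := norm_pos_iff.mpr ha
    rw [interpPath, if_neg ha, norm_mul, Complex.norm_cpow_eq_rpow_re_of_pos hn]
    have : ((p : ℂ) * (1 - z / 2)).re = p * (1 - z.re / 2) := by
      rw [Complex.re_ofReal_mul]; simp
    rw [this, norm_div, Complex.norm_real, norm_norm, div_self hn.ne', one_mul]

theorem differentiable_interpPath (p : ℝ) (a : ℂ) :
    Differentiable ℂ fun z => interpPath p z a := by
  by_cases ha : a = 0
  · simp [interpPath, ha]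
  · have hn : (‖a‖ : ℂ) ≠ 0 := by simpa using ha
    simp only [interpPath, if_neg ha]
    refine Differentiable.const_mul (Differentiable.const_cpow (by fun_prop) (Or.inl hn)) _

theorem interpPath_eq_self {p : ℝ} (hp : 0 < p) (a : ℂ) :
    interpPath p ((2 - 2 / p : ℝ) : ℂ) a = a := by
  by_cases ha : a = 0
  · simp [interpPath, ha]
  · have hn : (‖a‖ : ℂ) ≠ 0 := by simpa using ha
    have hpc : (p : ℂ) ≠ 0 := by exact_mod_cast hp.ne'
    have : (p : ℂ) * (1 - ((2 - 2 / p : ℝ) : ℂ) / 2) = 1 := by push_cast; field_simp; ring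
    rw [interpPath, if_neg ha, this, Complex.cpow_one, div_mul_cancel₀ _ hn]

/-- Riesz–Thorin interpolation on the diagonal for a bilinear form on two finite-dimensional weighted
`ℓᵖ` spaces: bounds by `1` in the norms with exponents `1` and `2` give the bound by `1` for every
exponent in between. The index sets are sets of values, and the two vectors at which the conclusion
is stated are the inclusions; this is the shape in which simple functions present themselves. -/
theorem norm_bilinear_sum_le_rpow {I J : Finset ℂ} {w w' : ℂ → ℝ}
    (hw : ∀ i, 0 ≤ w i) (hw' : ∀ j, 0 ≤ w' j) (K : ℂ → ℂ → ℂ)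
    (h1 : ∀ x y : ℂ → ℂ, x 0 = 0 → y 0 = 0 → ‖∑ i ∈ I, ∑ j ∈ J, x i * y j * K i j‖ ≤
      (∑ i ∈ I, w i * ‖x i‖) * ∑ j ∈ J, w' j * ‖y j‖)
    (h2 : ∀ x y : ℂ → ℂ, x 0 = 0 → y 0 = 0 → ‖∑ i ∈ I, ∑ j ∈ J, x i * y j * K i j‖ ≤
      √(∑ i ∈ I, w i * ‖x i‖ ^ 2) * √(∑ j ∈ J, w' j * ‖y j‖ ^ 2))
    {p : ℝ} (hp1 : 1 ≤ p) (hp2 : p ≤ 2) :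
    ‖∑ i ∈ I, ∑ j ∈ J, i * j * K i j‖ ≤
      (∑ i ∈ I, w i * ‖i‖ ^ p) ^ (1 / p) * (∑ j ∈ J, w' j * ‖j‖ ^ p) ^ (1 / p) := by
  have hp : 0 < p := by linarith
  set P := ∑ i ∈ I, w i * ‖i‖ ^ p with hP
  set Q := ∑ j ∈ J, w' j * ‖j‖ ^ p with hQ
  have hP0 : 0 ≤ P := Finset.sum_nonneg fun i _ => mul_nonneg (hw i) (by positivity)
  have hQ0 : 0 ≤ Q := Finset.sum_nonneg fun i _ => mul_nonneg (hw' i) (by positivity)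
  let Φ : ℂ → ℂ := fun z => ∑ i ∈ I, ∑ j ∈ J, interpPath p z i * interpPath p z j * K i j
  have hdiff : Differentiable ℂ Φ := by
    refine Differentiable.fun_sum fun i _ => Differentiable.fun_sum fun j _ => ?_
    exact ((differentiable_interpPath p i).mul (differentiable_interpPath p j)).mul_const _
  have hpath : ∀ a z : ℂ, 0 ≤ z.re → z.re ≤ 1 → ‖interpPath p z a‖ ≤ 1 + ‖a‖ ^ p := by
    intro a z h0 h1
    rw [norm_interpPath (by nlinarith)]
    rcases le_total ‖a‖ 1 with h | h
    · have := Real.rpow_le_one (norm_nonneg a) h (z := p * (1 - z.re / 2)) (by nlinarith)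
      have : 0 ≤ ‖a‖ ^ p := by positivity
      linarith
    · have := Real.rpow_le_rpow_of_exponent_le h (show p * (1 - z.re / 2) ≤ p by nlinarith)
      linarith
  -- The interpolation parameter of the exponent `p`: `1 / p = 1 - θ / 2`.
  have hθ : (((2 - 2 / p : ℝ) : ℂ)) ∈ Complex.HadamardThreeLines.verticalClosedStrip 0 1 := by
    have h3 : 2 / p ≤ 2 := by rw [div_le_iff₀ hp]; linarith
    have h4 : 1 ≤ 2 / p := by rw [le_div_iff₀ hp]; linarith
    simp only [Complex.HadamardThreeLines.verticalClosedStrip, Set.mem_preimage,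
      Complex.ofReal_re, Set.mem_Icc]
    constructor <;> linarith
  have hbdd : BddAbove ((norm ∘ Φ) '' Complex.HadamardThreeLines.verticalClosedStrip 0 1) := by
    refine ⟨∑ i ∈ I, ∑ j ∈ J, (1 + ‖i‖ ^ p) * (1 + ‖j‖ ^ p) * ‖K i j‖, ?_⟩
    rintro _ ⟨z, hz, rfl⟩
    refine (norm_sum_le _ _).trans (Finset.sum_le_sum fun i _ => (norm_sum_le _ _).trans
      (Finset.sum_le_sum fun j _ => ?_))
    rw [norm_mul, norm_mul]
    gcongr
    · exact hpath _ _ hz.1 hz.2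
    · exact hpath _ _ hz.1 hz.2
  have key := Complex.HadamardThreeLines.norm_le_interp_of_mem_verticalClosedStrip₀₁' Φ
    (a := P * Q) (b := √P * √Q) hθ hdiff.diffContOnCl hbdd ?_ ?_
  · simp only [Φ, interpPath_eq_self hp, Complex.ofReal_re] at key
    refine key.trans (le_of_eq ?_)
    rw [← Real.sqrt_mul hP0, Real.sqrt_eq_rpow, ← Real.rpow_mul (mul_nonneg hP0 hQ0),
      ← Real.rpow_add_of_nonneg (mul_nonneg hP0 hQ0), ← Real.mul_rpow hP0 hQ0]
    · congr 1; field_simp; ring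
    · have : 1 ≤ 2 / p := by rw [le_div_iff₀ hp]; linarith
      linarith
    · have : 2 / p ≤ 2 := by rw [div_le_iff₀ hp]; linarith
      linarith
  · intro z hz
    have hz : z.re = 0 := hz
    refine (h1 _ _ (interpPath_zero p z) (interpPath_zero p z)).trans (le_of_eq ?_)
    simp [norm_interpPath (p := p) (z := z) (by simp [hz, hp.ne']), hz, hP, hQ]
  · intro z hz
    have hz : z.re = 1 := hz
    refine (h2 _ _ (interpPath_zero p z) (interpPath_zero p z)).trans (le_of_eq ?_)
    have : ∀ a : ℂ, ‖interpPath p z a‖ ^ 2 = ‖a‖ ^ p := fun a => by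
      rw [norm_interpPath (by rw [hz]; nlinarith), hz, ← Real.rpow_natCast,
        ← Real.rpow_mul (norm_nonneg _)]
      congr 1; push_cast; ring
    simp [this, hP, hQ]

/-! ### Interpolation of bilinear forms on `L²` -/

section Interpolation
variable {α : Type*} [MeasurableSpace α] {μ : Measure α}

theorem memLp_simpleFunc_map {s : SimpleFunc α ℂ} (hs : Integrable s μ) {φ : ℂ → ℂ} (h0 : φ 0 = 0)
    {q : ℝ≥0∞} (hq0 : q ≠ 0) (hq : q ≠ ∞) : MemLp (s.map φ) q μ := by
  rw [SimpleFunc.memLp_iff_finMeasSupp hq0 hq]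
  exact (SimpleFunc.integrable_iff_finMeasSupp.mp hs).map h0

theorem integral_norm_simpleFunc_map_rpow {s : SimpleFunc α ℂ} (hs : Integrable s μ) {φ : ℂ → ℂ}
    (h0 : φ 0 = 0) {q : ℝ} (hq : 0 < q) :
    ∫ x, ‖s.map φ x‖ ^ q ∂μ = ∑ a ∈ s.range, μ.real (s ⁻¹' {a}) * ‖φ a‖ ^ q := by
  have hg : (fun a => ‖φ a‖ ^ q) 0 = 0 := by simp [h0, Real.zero_rpow hq.ne']
  have := SimpleFunc.map_integral (μ := μ) s (fun a => ‖φ a‖ ^ q) hs hg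
  rw [SimpleFunc.integral_eq_integral] at this
  · simpa using this
  · exact SimpleFunc.integrable_iff_finMeasSupp.mpr
      ((SimpleFunc.integrable_iff_finMeasSupp.mp hs).map hg)

open Classical in
/-- The indicator function of `{a} \ {0}` in `ℂ`. Composed with an integrable simple function, it is
the indicator of a level set; removing `0` keeps the measure of that set finite. -/
noncomputable def levelIndicator (a x : ℂ) : ℂ := if x = a ∧ x ≠ 0 then 1 else 0

theorem levelIndicator_zero (a : ℂ) : levelIndicator a 0 = 0 := by simp [levelIndicator]

/-- In `L²`, a function of a simple function `s` is a linear combination of the indicators of the level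
sets of `s`. -/
theorem toLp_simpleFunc_map {s : SimpleFunc α ℂ} (hs : Integrable s μ) {φ : ℂ → ℂ} (h0 : φ 0 = 0) :
    (memLp_simpleFunc_map hs h0 two_ne_zero ENNReal.ofNat_ne_top).toLp (s.map φ) =
      ∑ a ∈ s.range, φ a • (memLp_simpleFunc_map hs (levelIndicator_zero a) two_ne_zero
        ENNReal.ofNat_ne_top).toLp (s.map (levelIndicator a)) := by
  simp_rw [← MemLp.toLp_const_smul]
  apply Lp.ext
  refine (MemLp.coeFn_toLp _).trans ?_
  have hsum : (⇑(s.map φ) : α → ℂ) = ∑ a ∈ s.range, φ a • ⇑(s.map (levelIndicator a)) := by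
    ext x
    rw [Finset.sum_apply, Finset.sum_eq_single (s x)]
    · by_cases hx : s x = 0 <;> simp [levelIndicator, hx, h0]
    · intro b _ hb
      simp [levelIndicator, hb.symm]
    · intro h
      exact absurd (s.mem_range_self x) h
  rw [hsum]
  have h1 : ∀ᵐ x ∂μ, ∀ a ∈ s.range, ((memLp_simpleFunc_map hs (levelIndicator_zero a) two_ne_zero
        ENNReal.ofNat_ne_top).const_smul (φ a)).toLp (φ a • ⇑(s.map (levelIndicator a))) x =
        (φ a • ⇑(s.map (levelIndicator a))) x := by
    refine (ae_ball_iff (S := (s.range : Set ℂ)) s.range.countable_toSet).mpr fun a _ => ?_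
    exact MemLp.coeFn_toLp _
  filter_upwards [h1, Lp.coeFn_finsetSum s.range fun a =>
    ((memLp_simpleFunc_map hs (levelIndicator_zero a) two_ne_zero ENNReal.ofNat_ne_top).const_smul
      (φ a)).toLp (φ a • ⇑(s.map (levelIndicator a)))] with x hx hx2
  rw [hx2, Finset.sum_apply, Finset.sum_apply]
  exact Finset.sum_congr rfl fun a ha => (hx a ha).symm

variable (B : Lp ℂ 2 μ →L[ℂ] Lp ℂ 2 μ →L[ℂ] ℂ)

theorem norm_toLp_simpleFunc_map {s : SimpleFunc α ℂ} (hs : Integrable s μ) {φ : ℂ → ℂ}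
    (h0 : φ 0 = 0) :
    ‖(memLp_simpleFunc_map hs h0 two_ne_zero ENNReal.ofNat_ne_top).toLp (s.map φ)‖ =
      √(∑ a ∈ s.range, μ.real (s ⁻¹' {a}) * ‖φ a‖ ^ 2) := by
  have := integral_norm_simpleFunc_map_rpow hs h0 (q := 2) two_pos
  rw [Lp.norm_toLp, MemLp.eLpNorm_eq_integral_rpow_norm two_ne_zero ENNReal.ofNat_ne_top
    (memLp_simpleFunc_map hs h0 two_ne_zero ENNReal.ofNat_ne_top), ENNReal.toReal_ofReal
    (by positivity), ENNReal.toReal_ofNat, this, Real.sqrt_eq_rpow]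
  norm_num

/-- Interpolation between `L¹ × L¹` and `L² × L²` of a bounded bilinear form, on simple functions. -/
theorem enorm_bilinear_simpleFunc_le (h1 : ∀ u v : Lp ℂ 2 μ, Integrable u μ → Integrable v μ →
      ‖B u v‖ ≤ (∫ x, ‖u x‖ ∂μ) * ∫ x, ‖v x‖ ∂μ)
    (h2 : ∀ u v : Lp ℂ 2 μ, ‖B u v‖ ≤ ‖u‖ * ‖v‖) {p : ℝ} (hp1 : 1 ≤ p) (hp2 : p ≤ 2)
    {s t : SimpleFunc α ℂ} (hs : MemLp s 2 μ) (ht : MemLp t 2 μ) :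
    ‖B (hs.toLp s) (ht.toLp t)‖ₑ ≤
      eLpNorm s (ENNReal.ofReal p) μ * eLpNorm t (ENNReal.ofReal p) μ := by
  have hp : 0 < p := by linarith
  have hp' : ENNReal.ofReal p ≠ 0 := by simpa using hp
  have hsi := (SimpleFunc.memLp_iff_integrable two_ne_zero ENNReal.ofNat_ne_top).mp hs
  have hti := (SimpleFunc.memLp_iff_integrable two_ne_zero ENNReal.ofNat_ne_top).mp ht
  let e (r : SimpleFunc α ℂ) (hr : Integrable r μ) (a : ℂ) : Lp ℂ 2 μ :=
    (memLp_simpleFunc_map hr (levelIndicator_zero a) two_ne_zero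
      ENNReal.ofNat_ne_top).toLp (r.map (levelIndicator a))
  have hB : ∀ x y : ℂ → ℂ, ∀ (hx : x 0 = 0) (hy : y 0 = 0),
      B ((memLp_simpleFunc_map hsi hx two_ne_zero ENNReal.ofNat_ne_top).toLp (s.map x))
        ((memLp_simpleFunc_map hti hy two_ne_zero ENNReal.ofNat_ne_top).toLp (t.map y)) =
      ∑ i ∈ s.range, ∑ j ∈ t.range, x i * y j * B (e s hsi i) (e t hti j) := by
    intro x y hx hy
    rw [toLp_simpleFunc_map hsi hx, toLp_simpleFunc_map hti hy]
    simp only [map_sum, map_smul, _root_.sum_apply, _root_.smul_apply,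
      smul_eq_mul, Finset.mul_sum, e]
    rw [Finset.sum_comm]
    refine Finset.sum_congr rfl fun i _ => Finset.sum_congr rfl fun j _ => by ring
  have key := norm_bilinear_sum_le_rpow (I := s.range) (J := t.range)
    (w := fun a => μ.real (s ⁻¹' {a})) (w' := fun a => μ.real (t ⁻¹' {a}))
    (fun _ => measureReal_nonneg) (fun _ => measureReal_nonneg)
    (fun i j => B (e s hsi i) (e t hti j)) ?_ ?_ hp1 hp2
  · have hid := hB id id rfl rfl
    have hle : ∀ r : SimpleFunc α ℂ, ∀ hr : Integrable r μ, eLpNorm r (ENNReal.ofReal p) μ =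
        ENNReal.ofReal ((∑ a ∈ r.range, μ.real (r ⁻¹' {a}) * ‖a‖ ^ p) ^ (1 / p)) := by
      intro r hr
      have h3 := integral_norm_simpleFunc_map_rpow hr (φ := id) rfl hp
      have h4 : MemLp r (ENNReal.ofReal p) μ :=
        (SimpleFunc.memLp_iff_integrable hp' ENNReal.ofReal_ne_top).mpr hr
      rw [h4.eLpNorm_eq_integral_rpow_norm hp' ENNReal.ofReal_ne_top,
        ENNReal.toReal_ofReal hp.le, one_div]
      simp only [SimpleFunc.map_apply, id] at h3
      rw [h3]
    rw [hle s hsi, hle t hti, ← ENNReal.ofReal_mul (by positivity), ← ofReal_norm]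
    refine ENNReal.ofReal_le_ofReal (le_trans (le_of_eq ?_) key)
    simp only [id] at hid
    rw [← hid]
    rfl
  · intro x y hx hy
    rw [← hB x y hx hy]
    have hL : ∀ (r : SimpleFunc α ℂ) (hr : Integrable r μ) (φ : ℂ → ℂ) (h0 : φ 0 = 0),
        Integrable ((memLp_simpleFunc_map hr h0 two_ne_zero ENNReal.ofNat_ne_top).toLp (r.map φ)) μ
        ∧ ∫ x, ‖(memLp_simpleFunc_map hr h0 two_ne_zero ENNReal.ofNat_ne_top).toLp
          (r.map φ) x‖ ∂μ = ∑ a ∈ r.range, μ.real (r ⁻¹' {a}) * ‖φ a‖ := by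
      intro r hr φ h0
      have hc := (memLp_simpleFunc_map hr h0 two_ne_zero ENNReal.ofNat_ne_top).coeFn_toLp
      constructor
      · rw [integrable_congr hc, ← memLp_one_iff_integrable]
        exact memLp_simpleFunc_map hr h0 one_ne_zero ENNReal.one_ne_top
      · have h3 := integral_norm_simpleFunc_map_rpow hr h0 one_pos
        simp only [Real.rpow_one] at h3
        rw [← h3]
        refine integral_congr_ae ?_
        filter_upwards [hc] with x hx
        rw [hx]
    have := h1 _ _ (hL s hsi x hx).1 (hL t hti y hy).1
    rwa [(hL s hsi x hx).2, (hL t hti y hy).2] at this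
  · intro x y hx hy
    rw [← hB x y hx hy, ← norm_toLp_simpleFunc_map hsi hx, ← norm_toLp_simpleFunc_map hti hy]
    exact h2 _ _

/-- Interpolation between `L¹ × L¹` and `L² × L²` of a bounded bilinear form on `L²`. Simple functions
approximate a function in `L²` and in `Lᵖ` at the same time. -/
theorem enorm_bilinear_le_eLpNorm_mul_eLpNorm
    (h1 : ∀ u v : Lp ℂ 2 μ, Integrable u μ → Integrable v μ →
      ‖B u v‖ ≤ (∫ x, ‖u x‖ ∂μ) * ∫ x, ‖v x‖ ∂μ)
    (h2 : ∀ u v : Lp ℂ 2 μ, ‖B u v‖ ≤ ‖u‖ * ‖v‖) {p : ℝ} (hp1 : 1 ≤ p) (hp2 : p ≤ 2)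
    (u v : Lp ℂ 2 μ) :
    ‖B u v‖ₑ ≤ eLpNorm u (ENNReal.ofReal p) μ * eLpNorm v (ENNReal.ofReal p) μ := by
  have hp : 0 < p := by linarith
  have hp' : ENNReal.ofReal p ≠ 0 := by simpa using hp
  have hp1' : 1 ≤ ENNReal.ofReal p := by simpa using hp1
  have hzero : ∀ r : Lp ℂ 2 μ, eLpNorm r (ENNReal.ofReal p) μ = 0 → r = 0 := fun r hr =>
    (Lp.eq_zero_iff_ae_eq_zero).mpr ((eLpNorm_eq_zero_iff (Lp.aestronglyMeasurable r) hp').mp hr)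
  by_cases hu0 : eLpNorm u (ENNReal.ofReal p) μ = 0
  · simp [hzero u hu0]
  by_cases hv0 : eLpNorm v (ENNReal.ofReal p) μ = 0
  · simp [hzero v hv0]
  by_cases hut : eLpNorm u (ENNReal.ofReal p) μ = ∞
  · simp [hut, ENNReal.top_mul hv0]
  by_cases hvt : eLpNorm v (ENNReal.ofReal p) μ = ∞
  · simp [hvt, ENNReal.mul_top hu0]
  have happ : ∀ r : Lp ℂ 2 μ, eLpNorm r (ENNReal.ofReal p) μ ≠ ∞ →
      ∃ (s : ℕ → SimpleFunc α ℂ) (hs : ∀ n, MemLp (s n) 2 μ),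
        Tendsto (fun n => (hs n).toLp (s n)) atTop (𝓝 r) ∧
        Tendsto (fun n => eLpNorm (⇑(s n) - ⇑r) (ENNReal.ofReal p) μ) atTop (𝓝 0) := by
    intro r hr
    have hm : Measurable r := (Lp.stronglyMeasurable r).measurable
    refine ⟨_, SimpleFunc.memLp_approxOn_range hm (Lp.memLp r), ?_,
      SimpleFunc.tendsto_approxOn_range_Lp_eLpNorm ENNReal.ofReal_ne_top hm hr.lt_top⟩
    have := SimpleFunc.tendsto_approxOn_range_Lp (p := 2) ENNReal.ofNat_ne_top hm (Lp.memLp r)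
    rwa [Lp.toLp_coeFn] at this
  obtain ⟨s, hs, hs2, hsp⟩ := happ u hut
  obtain ⟨t, ht, ht2, htp⟩ := happ v hvt
  have hB : Tendsto (fun n => ‖B ((hs n).toLp (s n)) ((ht n).toLp (t n))‖ₑ) atTop (𝓝 ‖B u v‖ₑ) :=
    ((B.continuous₂.tendsto (u, v)).comp (hs2.prodMk_nhds ht2)).enorm
  have hbd : ∀ n, ‖B ((hs n).toLp (s n)) ((ht n).toLp (t n))‖ₑ ≤
      (eLpNorm (⇑(s n) - ⇑u) (ENNReal.ofReal p) μ + eLpNorm u (ENNReal.ofReal p) μ) *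
      (eLpNorm (⇑(t n) - ⇑v) (ENNReal.ofReal p) μ + eLpNorm v (ENNReal.ofReal p) μ) := by
    intro n
    have htri : ∀ (r : SimpleFunc α ℂ) (w : Lp ℂ 2 μ), eLpNorm r (ENNReal.ofReal p) μ ≤
        eLpNorm (⇑r - ⇑w) (ENNReal.ofReal p) μ + eLpNorm w (ENNReal.ofReal p) μ := by
      intro r w
      have := eLpNorm_add_le (f := ⇑r - ⇑w) (g := ⇑w)
        (r.aestronglyMeasurable.sub (Lp.aestronglyMeasurable w)) (Lp.aestronglyMeasurable w) hp1'
      rwa [sub_add_cancel] at this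
    exact (enorm_bilinear_simpleFunc_le B h1 h2 hp1 hp2 (hs n) (ht n)).trans
      (mul_le_mul' (htri _ _) (htri _ _))
  refine le_of_tendsto_of_tendsto' hB ?_ hbd
  have h3 := hsp.add_const (eLpNorm u (ENNReal.ofReal p) μ)
  have h4 := htp.add_const (eLpNorm v (ENNReal.ofReal p) μ)
  rw [zero_add] at h3 h4
  exact ENNReal.Tendsto.mul h3 (Or.inl hu0) h4 (Or.inl hv0)
end Interpolation

/-! ### The Hausdorff–Young inequality -/

/-- The Cauchy–Schwarz inequality. -/
theorem integral_norm_mul_norm_le {α : Type*} [MeasurableSpace α] {μ : Measure α}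
    {u v : α → ℂ} (hu : MemLp u 2 μ) (hv : MemLp v 2 μ) :
    ∫ x, ‖u x‖ * ‖v x‖ ∂μ ≤ (eLpNorm u 2 μ).toReal * (eLpNorm v 2 μ).toReal := by
  have h2 : ENNReal.ofReal 2 = 2 := by norm_num
  have hn : ∀ {r : α → ℂ}, MemLp r 2 μ →
      (eLpNorm r 2 μ).toReal = (∫ x, ‖r x‖ ^ (2 : ℝ) ∂μ) ^ (1 / 2 : ℝ) := by
    intro r hr
    rw [hr.eLpNorm_eq_integral_rpow_norm two_ne_zero
      ENNReal.ofNat_ne_top, ENNReal.toReal_ofReal (by positivity)]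
    norm_num
  rw [hn hu, hn hv]
  exact integral_mul_norm_le_Lp_mul_Lq (by constructor <;> norm_num)
    (by rwa [h2]) (by rwa [h2])

/-- The bilinear form of the Hausdorff–Young inequality, for functions in `L²`. -/
theorem enorm_integral_fourier_mul_le {p : ℝ} (hp1 : 1 ≤ p) (hp2 : p ≤ 2)
    (u v : Lp ℂ 2 (volume : Measure ℝ)) :
    ‖∫ x, (𝓕 u : Lp ℂ 2 (volume : Measure ℝ)) x * v x‖ₑ ≤
      eLpNorm u (ENNReal.ofReal p) volume * eLpNorm v (ENNReal.ofReal p) volume := by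
  let M := (ContinuousLinearMap.mul ℂ ℂ).lpPairing (volume : Measure ℝ) 2 2
  let B : Lp ℂ 2 (volume : Measure ℝ) →L[ℂ] Lp ℂ 2 (volume : Measure ℝ) →L[ℂ] ℂ :=
    M ∘L (Lp.fourierTransformₗᵢ ℝ ℂ).toContinuousLinearEquiv.toContinuousLinearMap
  have hB : ∀ u v, B u v = ∫ x, (𝓕 u : Lp ℂ 2 (volume : Measure ℝ)) x * v x := fun u v =>
    (ContinuousLinearMap.mul ℂ ℂ).lpPairing_eq_integral _ _
  rw [← hB]
  refine enorm_bilinear_le_eLpNorm_mul_eLpNorm B ?_ ?_ hp1 hp2 u v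
  · intro u v hu hv
    rw [hB]
    have hF : (𝓕 u : Lp ℂ 2 (volume : Measure ℝ)) =ᵐ[volume] 𝓕 (u : ℝ → ℂ) := by
      have := saft_aux_fourier_ae u (Lp.memLp u) hu
      rwa [Lp.toLp_coeFn] at this
    refine (norm_integral_le_integral_norm _).trans ?_
    rw [← integral_const_mul]
    refine integral_mono_of_nonneg (Eventually.of_forall fun _ => norm_nonneg _)
      (hv.norm.const_mul _) ?_
    filter_upwards [hF] with x hx
    rw [norm_mul, hx]
    gcongr
    exact VectorFourier.norm_fourierIntegral_le_integral_norm _ _ _ _ _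
  · intro u v
    rw [hB, ← Lp.norm_fourier_eq u]
    refine (norm_integral_le_integral_norm _).trans ?_
    simp only [norm_mul, Lp.norm_def]
    exact integral_norm_mul_norm_le (Lp.memLp _) (Lp.memLp v)

/-! ### The uncertainty inequality for the Fourier transform -/

/-- Continuity of translations in `L²`. -/
theorem tendsto_eLpNorm_translate_sub {g : ℝ → ℂ} (hg : MemLp g 2 volume) :
    Tendsto (fun h : ℝ => eLpNorm (fun x => g (x + h) - g x) 2 volume) (𝓝 0) (𝓝 0) := by
  let τ : C(ℝ, C(ℝ, ℝ)) :=
    (ContinuousMap.mk (fun a : ℝ × ℝ => a.2 + a.1) (by fun_prop)).curry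
  have hτ : ∀ h x, τ h x = x + h := fun h x => rfl
  have hm : ∀ h, MeasurePreserving (τ h) (volume : Measure ℝ) volume := fun h =>
    measurePreserving_add_right volume h
  have h1 := Filter.Tendsto.compMeasurePreservingLp (p := 2) (l := 𝓝 (0 : ℝ)) (E := ℂ)
    (f := fun _ => hg.toLp g) tendsto_const_nhds (τ.continuous.tendsto 0) hm (hm 0)
    ENNReal.ofNat_ne_top
  rw [tendsto_iff_edist_tendsto_0] at h1
  refine h1.congr fun h => ?_
  rw [Lp.edist_def]
  have h0 : ∀ a, Lp.compMeasurePreserving (τ a) (hm a) (hg.toLp g) =ᵐ[volume]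
      fun x => g (x + a) := fun a =>
    (Lp.coeFn_compMeasurePreserving _ (hm a)).trans
      ((hm a).quasiMeasurePreserving.ae_eq_comp hg.coeFn_toLp)
  refine eLpNorm_congr_ae ?_
  filter_upwards [h0 h, h0 0] with x hx hx0
  rw [Pi.sub_apply, hx, hx0, add_zero]

/-- The Fourier transform turns the symmetric difference with step `h` into multiplication by
`2 i sin (2π h ξ)`, which is at most `4π |h| |ξ|` in modulus. -/
theorem norm_fourier_symmetric_difference_le {g : ℝ → ℂ} (hg : Integrable g) (h ξ : ℝ) :
    ‖𝓕 (fun x => g (x + h) - g (x - h)) ξ‖ ≤ 4 * Real.pi * |h| * ‖(ξ : ℂ) * 𝓕 g ξ‖ := by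
  have hs : ∀ a : ℝ, 𝓕 (fun x => g (x + a)) ξ = Real.fourierChar (a * ξ) • 𝓕 g ξ := by
    intro a
    have := congrFun (VectorFourier.fourierIntegral_comp_add_right Real.fourierChar
      (volume : Measure ℝ) (innerₗ ℝ) g a) ξ
    simp only [innerₗ_apply_apply, RCLike.inner_apply, conj_trivial] at this
    rw [mul_comm ξ a] at this
    exact this
  have hsub : 𝓕 (fun x => g (x + h) - g (x - h)) ξ =
      𝓕 (fun x => g (x + h)) ξ - 𝓕 (fun x => g (x + -h)) ξ := by
    simp only [Real.fourier_eq, smul_sub, sub_eq_add_neg (G := ℝ)]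
    exact integral_sub ((Real.fourierIntegral_convergent_iff ξ).2 (hg.comp_add_right h))
      ((Real.fourierIntegral_convergent_iff ξ).2 (hg.comp_add_right (-h)))
  have hphase : ‖((Real.fourierChar (h * ξ) : ℂ) - (Real.fourierChar (-h * ξ) : ℂ))‖ ≤
      4 * Real.pi * |h| * |ξ| := by
    have e : ((Real.fourierChar (h * ξ) : ℂ) - (Real.fourierChar (-h * ξ) : ℂ)) =
        ((2 * Real.sin (2 * Real.pi * (h * ξ)) : ℝ) : ℂ) * Complex.I := by
      simp only [Real.fourierChar_apply]
      push_cast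
      rw [Complex.exp_mul_I, Complex.exp_mul_I]
      simp only [neg_mul, mul_neg, Complex.cos_neg, Complex.sin_neg]
      ring
    rw [e, norm_mul, Complex.norm_I, mul_one, Complex.norm_real, Real.norm_eq_abs, abs_mul,
      abs_two]
    have := Real.abs_sin_le_abs (x := 2 * Real.pi * (h * ξ))
    rw [abs_mul, abs_mul, abs_two, abs_of_pos Real.pi_pos, abs_mul] at this
    linarith
  rw [hsub, hs, hs, Circle.smul_def, Circle.smul_def, ← sub_smul, norm_smul, norm_mul,
    Complex.norm_real, Real.norm_eq_abs, ← mul_assoc]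
  gcongr

/-- Plancherel's theorem moves the pairing to the Fourier side, where the Hausdorff–Young inequality
and the bound for symmetric differences apply. -/
theorem enorm_integral_mul_conj_difference_le {p : ℝ} (hp1 : 1 ≤ p) (hp2 : p ≤ 2) {u g : ℝ → ℂ}
    (hu : MemLp u 2 volume) (hg : MemLp g 2 volume) (hgi : Integrable g) (h : ℝ) :
    ‖∫ x, u x * (starRingEnd ℂ) (g (x + h) - g (x - h))‖ₑ ≤
      eLpNorm u (ENNReal.ofReal p) volume * (ENNReal.ofReal (4 * Real.pi * |h|) *
        eLpNorm (fun ξ : ℝ => (ξ : ℂ) * 𝓕 g ξ) (ENNReal.ofReal p) volume) := by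
  set d : ℝ → ℂ := fun x => g (x + h) - g (x - h) with hd
  have hdm : MemLp d 2 volume :=
    (hg.comp_measurePreserving (measurePreserving_add_right volume h)).sub
      (hg.comp_measurePreserving (measurePreserving_sub_right volume h))
  have hdi : Integrable d := (hgi.comp_add_right h).sub (hgi.comp_sub_right h)
  let Fd : Lp ℂ 2 (volume : Measure ℝ) := 𝓕 (hdm.toLp d)
  let Fu : Lp ℂ 2 (volume : Measure ℝ) := 𝓕 (hu.toLp u)
  have hFd : Fd =ᵐ[volume] 𝓕 d := saft_aux_fourier_ae d hdm hdi
  let v : ℝ → ℂ := fun ξ => (starRingEnd ℂ) (Fd ξ)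
  have hv : MemLp v 2 volume := (Lp.memLp Fd).star
  have e1 : ∫ x, u x * (starRingEnd ℂ) (d x) = ∫ x, Fu x * (hv.toLp v) x := by
    have h1 := Lp.inner_fourier_eq (hdm.toLp d) (hu.toLp u)
    rw [L2.inner_def, L2.inner_def] at h1
    have h2 : ∫ x, u x * (starRingEnd ℂ) (d x) =
        ∫ x, inner ℂ ((hdm.toLp d) x) ((hu.toLp u) x) := by
      refine integral_congr_ae ?_
      filter_upwards [hdm.coeFn_toLp, hu.coeFn_toLp] with x hx hx'
      rw [hx, hx', RCLike.inner_apply]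
    rw [h2, ← h1]
    refine integral_congr_ae ?_
    filter_upwards [hv.coeFn_toLp] with x hx
    rw [hx, RCLike.inner_apply]
  have e2 : eLpNorm (hv.toLp v) (ENNReal.ofReal p) volume ≤ ENNReal.ofReal (4 * Real.pi * |h|) *
        eLpNorm (fun ξ : ℝ => (ξ : ℂ) * 𝓕 g ξ) (ENNReal.ofReal p) volume := by
    refine eLpNorm_le_mul_eLpNorm_of_ae_le_mul ?_ _
    filter_upwards [hv.coeFn_toLp, hFd] with ξ h1 h2
    rw [h1, RCLike.norm_conj, h2]
    exact norm_fourier_symmetric_difference_le hgi h ξ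
  rw [e1]
  refine (enorm_integral_fourier_mul_le hp1 hp2 (hu.toLp u) (hv.toLp v)).trans ?_
  rw [eLpNorm_congr_ae hu.coeFn_toLp]
  gcongr

/-- A discrete integration by parts: the shift `x ↦ x + h` in the second half of the pairing moves
the difference from `g` to the weight `s`. -/
theorem re_integral_mul_conj_difference {s : ℝ → ℝ} (hs : Measurable s) {C : ℝ}
    (hC : ∀ x, |s x| ≤ C) {g : ℝ → ℂ} (hg : MemLp g 2 volume) (h : ℝ) :
    (∫ x, (s x * g x) * (starRingEnd ℂ) (g (x + h) - g (x - h))).re =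
      -∫ x, (s (x + h) - s x) * (g x * (starRingEnd ℂ) (g (x + h))).re := by
  have hsg : ∀ (r : ℝ → ℝ), Measurable r → (∀ x, |r x| ≤ C) → ∀ {w : ℝ → ℂ}, MemLp w 2 volume →
      MemLp (fun x => (r x : ℂ) * w x) 2 volume := by
    intro r hr hrC w hw
    refine MemLp.of_le_mul (c := C) hw ?_ (Eventually.of_forall fun x => ?_)
    · exact (Complex.measurable_ofReal.comp hr).aestronglyMeasurable.mul hw.1
    · rw [norm_mul, Complex.norm_real]
      gcongr
      exact hrC x
  have hgp : MemLp (fun x => g (x + h)) 2 volume :=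
    hg.comp_measurePreserving (measurePreserving_add_right volume h)
  have hgm : MemLp (fun x => g (x - h)) 2 volume :=
    hg.comp_measurePreserving (measurePreserving_sub_right volume h)
  have i1 : Integrable fun x => (s x * g x) * (starRingEnd ℂ) (g (x + h)) :=
    (hsg s hs hC hg).integrable_mul hgp.star
  have i2 : Integrable fun x => (s x * g x) * (starRingEnd ℂ) (g (x - h)) :=
    (hsg s hs hC hg).integrable_mul hgm.star
  have i3 : Integrable fun x => (s (x + h) * g (x + h)) * (starRingEnd ℂ) (g x) := by
    simpa using i2.comp_add_right h
  have e2 : ∫ x, (s x * g x) * (starRingEnd ℂ) (g (x - h)) =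
      ∫ x, (s (x + h) * g (x + h)) * (starRingEnd ℂ) (g x) := by
    rw [← integral_add_right_eq_self _ h]
    simp
  simp only [map_sub, mul_sub]
  rw [integral_sub i1 i2, e2, ← integral_sub i1 i3, ← integral_neg]
  refine (integral_re (i1.sub i3)).symm.trans ?_
  refine integral_congr_ae (Eventually.of_forall fun x => ?_)
  simp only [Pi.sub_apply, RCLike.re_eq_complex_re, Complex.sub_re, Complex.mul_re, Complex.mul_im,
    Complex.conj_re, Complex.conj_im, Complex.ofReal_re, Complex.ofReal_im]
  ring

/-- The truncation of `x` to the interval `[-1/h, 1/h]`, for `h > 0`. -/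
noncomputable def clip (h x : ℝ) : ℝ := max (-(1 / h)) (min (1 / h) x)

/-- The difference quotients of the truncations are bounded by `1` and tend to `1`, so the shifted
weighted integrals recover `‖g‖₂²`. -/
theorem tendsto_integral_clip_slope {g : ℝ → ℂ} (hg : MemLp g 2 volume) :
    Tendsto (fun h : ℝ => ∫ x, (clip h (x + h) - clip h x) / h *
      (g x * (starRingEnd ℂ) (g (x + h))).re) (𝓝[>] 0) (𝓝 (∫ x, ‖g x‖ ^ 2)) := by
  have hq : ∀ h : ℝ, 0 < h → ∀ x, |(clip h (x + h) - clip h x) / h| ≤ 1 := by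
    intro h hh x
    rw [abs_div, abs_of_pos hh, div_le_one hh]
    have : 0 < 1 / h := by positivity
    rw [clip, clip, abs_le]
    rcases max_cases (-(1 / h)) (min (1 / h) (x + h)) with h1 | h1 <;>
    rcases max_cases (-(1 / h)) (min (1 / h) x) with h2 | h2 <;>
    rcases min_cases (1 / h) (x + h) with h3 | h3 <;>
    rcases min_cases (1 / h) x with h4 | h4 <;> constructor <;> linarith
  have hqm : ∀ h, Measurable fun x => (clip h (x + h) - clip h x) / h := by
    intro h
    unfold clip
    fun_prop
  have hsq : Integrable fun x => ‖g x‖ ^ 2 := hg.integrable_norm_pow two_ne_zero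
  have hτ : ∀ h : ℝ, MemLp (fun x => g (x + h)) 2 volume := fun h =>
    hg.comp_measurePreserving (measurePreserving_add_right volume h)
  have hδ : ∀ h : ℝ, MemLp (fun x => g (x + h) - g x) 2 volume := fun h => (hτ h).sub hg
  -- Split `g (x + h) = g x + (g (x + h) - g x)`: dominated convergence handles the first part, and
  -- continuity of translations in `L²` the second.
  have hmain : Tendsto (fun h : ℝ => ∫ x, (clip h (x + h) - clip h x) / h * ‖g x‖ ^ 2) (𝓝[>] 0)
      (𝓝 (∫ x, ‖g x‖ ^ 2)) := by
    refine tendsto_integral_filter_of_dominated_convergence (fun x => ‖g x‖ ^ 2) ?_ ?_ hsq ?_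
    · exact Eventually.of_forall fun h => (hqm h).aestronglyMeasurable.mul hsq.1
    · filter_upwards [self_mem_nhdsWithin] with h hh
      refine Eventually.of_forall fun x => ?_
      rw [norm_mul, norm_pow, norm_norm]
      exact mul_le_of_le_one_left (by positivity) (hq h hh x)
    · refine Eventually.of_forall fun x => tendsto_const_nhds.congr' ?_
      have h1 : Tendsto (fun h : ℝ => 1 / h) (𝓝[>] 0) atTop := by
        simpa using tendsto_inv_nhdsGT_zero (𝕜 := ℝ)
      filter_upwards [self_mem_nhdsWithin, h1.eventually_ge_atTop (|x| + 1),
        nhdsWithin_le_nhds (Iio_mem_nhds (one_pos (α := ℝ)))] with h hh hx hh1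
      have hh : 0 < h := hh
      have hh1 : h < 1 := hh1
      have := neg_abs_le x
      have := le_abs_self x
      have e : ∀ y, -(1 / h) ≤ y → y ≤ 1 / h → clip h y = y := fun y h1 h2 => by
        rw [clip, min_eq_right h2, max_eq_right h1]
      rw [e _ (by linarith) (by linarith), e _ (by linarith) (by linarith), add_sub_cancel_left,
        div_self hh.ne', one_mul]
  have herr : Tendsto (fun h : ℝ => ∫ x, (clip h (x + h) - clip h x) / h *
      (g x * (starRingEnd ℂ) (g (x + h) - g x)).re) (𝓝[>] 0) (𝓝 0) := by
    have hlim : Tendsto (fun h : ℝ => (eLpNorm g 2 volume).toReal *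
        (eLpNorm (fun x => g (x + h) - g x) 2 volume).toReal) (𝓝[>] 0) (𝓝 0) := by
      have := (ENNReal.tendsto_toReal ENNReal.zero_ne_top).comp
        ((tendsto_eLpNorm_translate_sub hg).mono_left nhdsWithin_le_nhds (y := 𝓝[>] 0))
      simpa using this.const_mul (eLpNorm g 2 volume).toReal
    refine squeeze_zero_norm' ?_ hlim
    filter_upwards [self_mem_nhdsWithin] with h hh
    refine (norm_integral_le_integral_norm _).trans
      (le_trans ?_ (integral_norm_mul_norm_le hg (hδ h)))
    refine integral_mono_of_nonneg (Eventually.of_forall fun _ => norm_nonneg _)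
      (hg.norm.integrable_mul (hδ h).norm) (Eventually.of_forall fun x => ?_)
    dsimp only
    rw [norm_mul]
    refine (mul_le_of_le_one_left (norm_nonneg _) (hq h hh x)).trans ?_
    refine (Complex.abs_re_le_norm _).trans ?_
    rw [norm_mul, RCLike.norm_conj]
  have hadd := hmain.add herr
  rw [add_zero] at hadd
  refine hadd.congr' ?_
  filter_upwards [self_mem_nhdsWithin] with h hh
  rw [← integral_add]
  · refine integral_congr_ae (Eventually.of_forall fun x => ?_)
    simp only [Complex.sq_norm, Complex.normSq_apply, map_sub, Complex.mul_re, Complex.sub_re,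
      Complex.sub_im, Complex.conj_re, Complex.conj_im]
    ring
  · exact hsq.bdd_mul (hqm h).aestronglyMeasurable (Eventually.of_forall (hq h hh))
  · exact (hg.integrable_mul (hδ h).star).re.bdd_mul (hqm h).aestronglyMeasurable
      (Eventually.of_forall (hq h hh))

/-- The uncertainty inequality for the Fourier transform, for integrable `g ∈ L²`. -/
theorem eLpNorm_sq_le_mul_fourier {p : ℝ} (hp1 : 1 ≤ p) (hp2 : p ≤ 2) {g : ℝ → ℂ}
    (hg : MemLp g 2 volume) (hgi : Integrable g) :
    eLpNorm g 2 volume ^ 2 ≤ ENNReal.ofReal (4 * Real.pi) *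
      (eLpNorm (fun x : ℝ => (x : ℂ) * g x) (ENNReal.ofReal p) volume *
        eLpNorm (fun ξ : ℝ => (ξ : ℂ) * 𝓕 g ξ) (ENNReal.ofReal p) volume) := by
  set X := eLpNorm (fun x : ℝ => (x : ℂ) * g x) (ENNReal.ofReal p) volume
  set Y := eLpNorm (fun ξ : ℝ => (ξ : ℂ) * 𝓕 g ξ) (ENNReal.ofReal p) volume
  by_cases htop : ENNReal.ofReal (4 * Real.pi) * (X * Y) = ∞
  · rw [htop]; exact le_top
  have hnorm : eLpNorm g 2 volume ^ 2 = ENNReal.ofReal (∫ x, ‖g x‖ ^ 2) := by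
    rw [hg.eLpNorm_eq_integral_rpow_norm two_ne_zero ENNReal.ofNat_ne_top,
      ← ENNReal.ofReal_pow (by positivity), ← Real.rpow_natCast, ← Real.rpow_mul (by positivity)]
    norm_num
  rw [hnorm, ENNReal.ofReal_le_iff_le_toReal htop]
  refine le_of_tendsto (tendsto_integral_clip_slope hg) ?_
  filter_upwards [self_mem_nhdsWithin] with h hh
  have hh : 0 < h := hh
  have hinv : 0 < 1 / h := by positivity
  have hcm : Measurable (clip h) := by unfold clip; fun_prop
  have hcC : ∀ x, |clip h x| ≤ 1 / h := fun x => by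
    rw [abs_le, clip]
    exact ⟨le_max_left _ _, max_le (by linarith) (min_le_left _ _)⟩
  have hcx : ∀ x, |clip h x| ≤ |x| := fun x => by
    rw [clip, abs_le]
    have := neg_abs_le x
    have := le_abs_self x
    rcases max_cases (-(1 / h)) (min (1 / h) x) with h2 | h2 <;>
    rcases min_cases (1 / h) x with h4 | h4 <;> constructor <;> linarith
  have hu : MemLp (fun x => (clip h x : ℂ) * g x) 2 volume := by
    refine MemLp.of_le_mul (c := 1 / h) hg ?_ (Eventually.of_forall fun x => ?_)
    · exact (Complex.measurable_ofReal.comp hcm).aestronglyMeasurable.mul hg.1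
    · rw [norm_mul, Complex.norm_real]
      gcongr
      exact hcC x
  have h1 := enorm_integral_mul_conj_difference_le hp1 hp2 hu hg hgi h
  have h2 := re_integral_mul_conj_difference hcm hcC hg h
  have h3 : eLpNorm (fun x => (clip h x : ℂ) * g x) (ENNReal.ofReal p) volume ≤ X := by
    refine eLpNorm_mono fun x => ?_
    rw [norm_mul, norm_mul, Complex.norm_real, Complex.norm_real]
    gcongr
    exact hcx x
  have h4 : ‖∫ x, (clip h x * g x) * (starRingEnd ℂ) (g (x + h) - g (x - h))‖ₑ ≤
      ENNReal.ofReal h * (ENNReal.ofReal (4 * Real.pi) * (X * Y)) := by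
    refine h1.trans ((mul_le_mul_left h3 _).trans (le_of_eq ?_))
    rw [abs_of_pos hh, ENNReal.ofReal_mul (by positivity)]
    ring
  have h5 := ENNReal.toReal_mono (ENNReal.mul_ne_top ENNReal.ofReal_ne_top htop) h4
  rw [toReal_enorm, ENNReal.toReal_mul, ENNReal.toReal_ofReal hh.le] at h5
  have h6 := (neg_le_abs _).trans ((Complex.abs_re_le_norm _).trans h5)
  rw [h2, neg_neg] at h6
  have h7 : ∫ x, (clip h (x + h) - clip h x) / h * (g x * (starRingEnd ℂ) (g (x + h))).re =
      (∫ x, (clip h (x + h) - clip h x) * (g x * (starRingEnd ℂ) (g (x + h))).re) / h := by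
    rw [← integral_div]
    refine integral_congr_ae (Eventually.of_forall fun x => ?_)
    dsimp only
    ring
  rw [h7, div_le_iff₀ hh]
  linarith

/-! ### Integrability from a weighted bound -/

/-- If `|x| ≥ 1` and `a > x⁻²`, then `|x|ᵖ aᵖ⁻¹ = |x|²⁻ᵖ (x² a)ᵖ⁻¹ ≥ 1`, so the first summand
dominates `a`. If `|x| ≥ 1` and `a ≤ x⁻²`, the second one does; if `|x| ≤ 1`, then `a ≤ 1 + a²`. -/
theorem le_rpow_mul_add_sq {p : ℝ} (hp1 : 1 ≤ p) (hp2 : p ≤ 2) (x : ℝ) {a : ℝ} (ha : 0 ≤ a) :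
    a ≤ (|x| * a) ^ p + 2 * (1 + x ^ 2)⁻¹ + a ^ 2 := by
  have hX : 0 ≤ (|x| * a) ^ p := by positivity
  have hx2 : 0 < 1 + x ^ 2 := by positivity
  rcases le_total (|x|) 1 with hx | hx
  · have : 1 ≤ 2 * (1 + x ^ 2)⁻¹ := by
      rw [← div_eq_mul_inv, le_div_iff₀ hx2]
      have := (sq_le_one_iff_abs_le_one x).mpr hx
      linarith
    nlinarith [sq_nonneg (a - 1)]
  · have hx0 : 0 < |x| := by linarith
    rcases le_total (a * x ^ 2) 1 with h | h
    · have : a ≤ 2 * (1 + x ^ 2)⁻¹ := by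
        rw [← div_eq_mul_inv, le_div_iff₀ hx2]
        have : 1 ≤ x ^ 2 := (one_le_sq_iff_one_le_abs x).mpr hx
        nlinarith
      nlinarith [sq_nonneg a]
    · have hy : 1 ≤ |x| * (|x| * a) := by
        rw [← mul_assoc, ← sq, sq_abs]; linarith
      have hx2' : x ^ 2 = |x| ^ 2 := (sq_abs x).symm
      have ha0 : 0 < a := by
        rcases ha.lt_or_eq with h' | h'
        · exact h'
        · rw [← h'] at h; norm_num at h
      have key : a ≤ (|x| * a) ^ p := by
        have e : (|x| * a) ^ p = a * (|x| ^ (2 - p) * (|x| ^ 2 * a) ^ (p - 1)) := by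
          rw [Real.mul_rpow hx0.le ha, Real.mul_rpow (by positivity) ha, ← Real.rpow_natCast,
            ← Real.rpow_mul hx0.le, ← mul_assoc (|x| ^ (2 - p)), ← Real.rpow_add hx0,
            mul_left_comm, ← Real.rpow_one_add' ha (by linarith)]
          congr 2 <;> push_cast <;> ring
        rw [e]
        refine le_mul_of_one_le_right ha (one_le_mul_of_one_le_of_one_le ?_ ?_)
        · exact Real.one_le_rpow hx (by linarith)
        · exact Real.one_le_rpow (by rw [← hx2']; linarith) (by linarith)
      have : 0 ≤ 2 * (1 + x ^ 2)⁻¹ := by positivity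
      nlinarith [sq_nonneg a]

theorem integrable_of_memLp_two_of_memLp_mul {p : ℝ} (hp1 : 1 ≤ p) (hp2 : p ≤ 2) {g : ℝ → ℂ}
    (hg : MemLp g 2 volume)
    (hxg : MemLp (fun x : ℝ => (x : ℂ) * g x) (ENNReal.ofReal p) volume) : Integrable g := by
  have hp : 0 < p := by linarith
  have h1 := hxg.integrable_norm_rpow (by simpa using hp) ENNReal.ofReal_ne_top
  rw [ENNReal.toReal_ofReal hp.le] at h1
  refine Integrable.mono' ((h1.add (integrable_inv_one_add_sq.const_mul 2)).add
    (hg.integrable_norm_pow two_ne_zero)) hg.1 (Eventually.of_forall fun x => ?_)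
  have := le_rpow_mul_add_sq hp1 hp2 x (norm_nonneg (g x))
  simpa using this

/-! ### The special affine Fourier transform -/

namespace AugmentedMatrix
variable (Λ : AugmentedMatrix)

/-- The part of the kernel of the special affine Fourier transform that depends on `x` alone. -/
noncomputable def chirp (x : ℝ) : ℂ :=
  Complex.exp (((Λ.A * x ^ 2 + 2 * x * Λ.p) / (2 * Λ.B) : ℝ) * Complex.I)

/-- The part of the kernel of the special affine Fourier transform that depends on `ω` alone. -/
noncomputable def outerChirp (ω : ℝ) : ℂ := Complex.exp
  (((-2 * ω * (Λ.D * Λ.p - Λ.B * Λ.q) + Λ.D * ω ^ 2) / (2 * Λ.B) : ℝ) * Complex.I)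

theorem norm_chirp (x : ℝ) : ‖Λ.chirp x‖ = 1 := Complex.norm_exp_ofReal_mul_I _

theorem norm_outerChirp (ω : ℝ) : ‖Λ.outerChirp ω‖ = 1 := Complex.norm_exp_ofReal_mul_I _

theorem continuous_chirp : Continuous Λ.chirp := by unfold chirp; fun_prop

theorem continuous_outerChirp : Continuous Λ.outerChirp := by unfold outerChirp; fun_prop

variable {Λ}

theorem norm_saftConst : ‖saftConst Λ‖ = (2 * Real.pi * |Λ.B|) ^ (-(1 / 2) : ℝ) := by
  by_cases hB : Λ.B = 0
  · simp [saftConst, hB, Real.zero_rpow]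
  have hz : ((2 * Real.pi * Λ.B : ℝ) : ℂ) ≠ 0 := by
    exact_mod_cast mul_ne_zero (by positivity) hB
  rw [saftConst, norm_div, norm_one, Complex.norm_cpow_of_ne_zero hz, Complex.norm_real,
    Real.norm_eq_abs, abs_mul, abs_of_pos (by positivity : 0 < 2 * Real.pi),
    Real.rpow_neg (by positivity)]
  norm_num

/-- The special affine Fourier integral is a chirped, rescaled Fourier transform of the chirped
function. -/
theorem saftIntegral_eq (hB : Λ.B ≠ 0) (f : ℝ → ℂ) (ω : ℝ) :
    saftIntegral Λ f ω = saftConst Λ * Λ.outerChirp ω *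
      𝓕 (fun x => Λ.chirp x * f x) ((2 * Real.pi * Λ.B)⁻¹ * ω) := by
  have hBC : (Λ.B : ℂ) ≠ 0 := by exact_mod_cast hB
  have hpi : (Real.pi : ℂ) ≠ 0 := by exact_mod_cast Real.pi_ne_zero
  rw [Real.fourier_real_eq_integral_exp_smul, saftIntegral, ← integral_const_mul]
  congr 1
  ext x
  have hexp : Complex.exp (Complex.I / (2 * (Λ.B : ℂ)) *
      ((Λ.A * x ^ 2 + 2 * x * (Λ.p - ω) - 2 * ω * (Λ.D * Λ.p - Λ.B * Λ.q)
        + Λ.D * ω ^ 2 : ℝ) : ℂ)) = Λ.outerChirp ω *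
      (Complex.exp (((-2 * Real.pi * x * ((2 * Real.pi * Λ.B)⁻¹ * ω) : ℝ) : ℂ) * Complex.I) *
        Λ.chirp x) := by
    rw [chirp, outerChirp, ← Complex.exp_add, ← Complex.exp_add]
    congr 1
    push_cast
    field_simp
    ring
  rw [saftKernel, hexp, smul_eq_mul]
  ring

theorem norm_saftIntegral (hB : Λ.B ≠ 0) (f : ℝ → ℂ) (ω : ℝ) :
    ‖saftIntegral Λ f ω‖ = (2 * Real.pi * |Λ.B|) ^ (-(1 / 2) : ℝ) *
      ‖𝓕 (fun x => Λ.chirp x * f x) ((2 * Real.pi * Λ.B)⁻¹ * ω)‖ := by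
  rw [saftIntegral_eq hB, norm_mul, norm_mul, norm_saftConst, norm_outerChirp, mul_one]

theorem memLp_chirp_mul {f : ℝ → ℂ} {q : ℝ≥0∞} (hf : MemLp f q volume) :
    MemLp (fun x => Λ.chirp x * f x) q volume :=
  hf.of_le (Λ.continuous_chirp.aestronglyMeasurable.mul hf.1)
    (Eventually.of_forall fun x => by rw [norm_mul, norm_chirp, one_mul])

theorem continuous_saftIntegral (hB : Λ.B ≠ 0) {f : ℝ → ℂ} (hf : Integrable f) :
    Continuous (saftIntegral Λ f) := by
  have hc : Continuous (𝓕 (fun x => Λ.chirp x * f x)) :=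
    VectorFourier.fourierIntegral_continuous Real.continuous_fourierChar
      (by exact continuous_inner)
      (memLp_one_iff_integrable.mp (memLp_chirp_mul (memLp_one_iff_integrable.mpr hf)))
  rw [show saftIntegral Λ f = _ from funext (saftIntegral_eq hB f)]
  exact (continuous_const.mul Λ.continuous_outerChirp).mul (hc.comp (by fun_prop))

theorem isSAFT_saft (f : Lp ℂ 2 (volume : Measure ℝ)) : IsSAFT Λ f (saft Λ f) :=
  (exists_isSAFT Λ f).choose_spec

theorem integrable_truncation {f : ℝ → ℂ} (hf : MemLp f 2 volume) (R : ℝ) :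
    Integrable ((Set.Icc (-R) R).indicator f) := by
  rw [integrable_indicator_iff measurableSet_Icc]
  have : MemLp f 2 (volume.restrict (Set.Icc (-R) R)) := hf.restrict _
  exact this.integrable (by norm_num)

/-- For integrable `f ∈ L²`, the `L²` limit defining the transform agrees with the pointwise limit of
the truncated integrals. -/
theorem saft_ae_eq_saftIntegral (hB : Λ.B ≠ 0) (f : Lp ℂ 2 (volume : Measure ℝ))
    (hf : Integrable f) : saft Λ f =ᵐ[volume] saftIntegral Λ f := by
  have h1 : TendstoInMeasure volume
      (fun R : ℝ => saftIntegral Λ ((Set.Icc (-R) R).indicator f)) atTop (saft Λ f) :=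
    tendstoInMeasure_of_tendsto_eLpNorm two_ne_zero
      (fun R => (continuous_saftIntegral hB
        (integrable_truncation (Lp.memLp f) R)).aestronglyMeasurable)
      (Lp.aestronglyMeasurable _) (isSAFT_saft f)
  obtain ⟨R, hR, hlim⟩ := h1.exists_seq_tendsto_ae'
  filter_upwards [hlim] with ω hω
  refine tendsto_nhds_unique hω ?_
  have hk : ∀ x, ‖saftKernel Λ x ω‖ ≤ ‖saftConst Λ‖ := fun x => by
    have : Complex.I / (2 * (Λ.B : ℂ)) * ((Λ.A * x ^ 2 + 2 * x * (Λ.p - ω) -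
        2 * ω * (Λ.D * Λ.p - Λ.B * Λ.q) + Λ.D * ω ^ 2 : ℝ) : ℂ) =
        (((Λ.A * x ^ 2 + 2 * x * (Λ.p - ω) -
        2 * ω * (Λ.D * Λ.p - Λ.B * Λ.q) + Λ.D * ω ^ 2) / (2 * Λ.B) : ℝ) : ℂ) * Complex.I := by
      push_cast; ring
    rw [saftKernel, this, norm_mul, Complex.norm_exp_ofReal_mul_I, mul_one]
  have hkc : Continuous fun x => saftKernel Λ x ω := by unfold saftKernel; fun_prop
  refine tendsto_integral_filter_of_dominated_convergence (fun x => ‖f x‖ * ‖saftConst Λ‖)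
    ?_ ?_ (hf.norm.mul_const _) ?_
  · exact Eventually.of_forall fun n =>
      (hf.1.indicator measurableSet_Icc).mul hkc.aestronglyMeasurable
  · refine Eventually.of_forall fun n => Eventually.of_forall fun x => ?_
    rw [norm_mul]
    exact mul_le_mul (norm_indicator_le_norm_self _ _) (hk x) (norm_nonneg _) (norm_nonneg _)
  · refine Eventually.of_forall fun x => tendsto_const_nhds.congr' ?_
    filter_upwards [hR.eventually_ge_atTop |x|] with n hn
    rw [Set.indicator_of_mem (show x ∈ Set.Icc (-R n) (R n) from abs_le.mp hn)]

theorem eLpNorm_comp_mul_left {b : ℝ} (hb : b ≠ 0) (h : ℝ → ℂ) {q : ℝ≥0∞} (hq : q ≠ ∞) :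
    eLpNorm (fun ω => h (b * ω)) q volume =
      (ENNReal.ofReal |b⁻¹|) ^ (1 / q.toReal) * eLpNorm h q volume := by
  have hemb : MeasurableEmbedding (fun ω : ℝ => b * ω) :=
    (Homeomorph.mulLeft₀ b hb).measurableEmbedding
  have := hemb.eLpNorm_map_measure (g := h) (p := q) (μ := volume)
  rw [Real.map_volume_mul_left hb] at this
  rw [show (fun ω => h (b * ω)) = h ∘ (fun ω => b * ω) from rfl, ← this,
    eLpNorm_smul_measure_of_ne_top hq]
  simp

/-- The transform is injective: Plancherel's theorem makes it a multiple of an isometry on the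
truncations of `f`. -/
theorem eq_zero_of_saft_eq_zero (hB : Λ.B ≠ 0) (f : Lp ℂ 2 (volume : Measure ℝ))
    (h0 : saft Λ f = 0) : f = 0 := by
  have hb : (2 * Real.pi * Λ.B)⁻¹ ≠ 0 := inv_ne_zero (by positivity)
  set κ : ℝ≥0∞ := ENNReal.ofReal ((2 * Real.pi * |Λ.B|) ^ (-(1 / 2) : ℝ)) *
    (ENNReal.ofReal |(2 * Real.pi * Λ.B)⁻¹⁻¹|) ^ (1 / (2 : ℝ≥0∞).toReal) with hκ
  have hκ0 : κ ≠ 0 := by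
    refine mul_ne_zero ?_ ?_
    · simpa using by positivity
    · rw [Ne, ENNReal.rpow_eq_zero_iff]
      simp [hB, Real.pi_ne_zero]
  have hnorm : ∀ R : ℝ, eLpNorm (saftIntegral Λ ((Set.Icc (-R) R).indicator f)) 2 volume =
      κ * eLpNorm ((Set.Icc (-R) R).indicator f) 2 volume := by
    intro R
    set fR := (Set.Icc (-R) R).indicator (f : ℝ → ℂ)
    have hfR : MemLp fR 2 volume := (Lp.memLp f).indicator measurableSet_Icc
    have hg := memLp_chirp_mul (Λ := Λ) hfR
    have hgi := memLp_one_iff_integrable.mp (memLp_chirp_mul (Λ := Λ)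
      (memLp_one_iff_integrable.mpr (integrable_truncation (Lp.memLp f) R)))
    have e1 : eLpNorm (saftIntegral Λ fR) 2 volume =
        eLpNorm (((2 * Real.pi * |Λ.B|) ^ (-(1 / 2) : ℝ)) • fun ω =>
          𝓕 (fun x => Λ.chirp x * fR x) ((2 * Real.pi * Λ.B)⁻¹ * ω)) 2 volume := by
      refine eLpNorm_congr_norm_ae (Eventually.of_forall fun ω => ?_)
      rw [norm_saftIntegral hB, Pi.smul_apply, norm_smul, Real.norm_of_nonneg (by positivity)]
    have e2 : eLpNorm (𝓕 (fun x => Λ.chirp x * fR x)) 2 volume = eLpNorm fR 2 volume := by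
      rw [← eLpNorm_congr_ae (saft_aux_fourier_ae _ hg hgi), ← Lp.enorm_def, ← ofReal_norm,
        Lp.norm_fourier_eq, ofReal_norm, Lp.enorm_def, eLpNorm_congr_ae hg.coeFn_toLp]
      refine eLpNorm_congr_norm_ae (Eventually.of_forall fun x => ?_)
      rw [norm_mul, norm_chirp, one_mul]
    rw [e1, eLpNorm_const_smul, eLpNorm_comp_mul_left hb _ ENNReal.ofNat_ne_top, e2, hκ,
      Real.enorm_of_nonneg (by positivity), ← mul_assoc]
  have hlim : Tendsto (fun R : ℝ => κ * eLpNorm ((Set.Icc (-R) R).indicator f) 2 volume)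
      atTop (𝓝 0) := by
    refine (isSAFT_saft (Λ := Λ) f).congr fun R => ?_
    rw [← hnorm, h0]
    refine eLpNorm_congr_ae ?_
    filter_upwards [Lp.coeFn_zero ℂ 2 (volume : Measure ℝ)] with ω hω
    rw [hω, Pi.zero_apply, sub_zero]
  -- The norms of the truncations increase with `R`, so a limit `0` forces each of them to vanish.
  have hmono : ∀ R : ℝ, eLpNorm ((Set.Icc (-R) R).indicator f) 2 volume = 0 := by
    intro R
    have h1 : κ * eLpNorm ((Set.Icc (-R) R).indicator f) 2 volume ≤ 0 := by
      refine ge_of_tendsto hlim ?_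
      filter_upwards [eventually_ge_atTop R] with R' hR'
      gcongr
      exact eLpNorm_mono fun x =>
        norm_indicator_le_of_subset (Set.Icc_subset_Icc (by linarith) hR') _ _
    exact (mul_eq_zero.mp (le_antisymm h1 zero_le)).resolve_left hκ0
  have htr := saft_aux_trunc f (Lp.memLp f)
  have hfin : eLpNorm f 2 volume = 0 := by
    refine tendsto_nhds_unique (f := fun _ : ℝ => eLpNorm f 2 volume) (l := atTop)
      tendsto_const_nhds (tendsto_of_tendsto_of_tendsto_of_le_of_le tendsto_const_nhds htr
        (fun _ => zero_le) fun R => ?_)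
    have h2 := eLpNorm_sub_le (f := (Set.Icc (-R) R).indicator f)
      (g := (Set.Icc (-R) R).indicator f - f) (μ := volume) (p := 2)
      ((Lp.aestronglyMeasurable f).indicator measurableSet_Icc)
      (((Lp.aestronglyMeasurable f).indicator measurableSet_Icc).sub (Lp.aestronglyMeasurable f))
      (by norm_num)
    rwa [sub_sub_cancel, hmono R, zero_add] at h2
  exact (Lp.eq_zero_iff_ae_eq_zero).mpr
    ((eLpNorm_eq_zero_iff (Lp.aestronglyMeasurable f) two_ne_zero).mp hfin)

theorem lintegral_rpow_eq_eLpNorm {p : ℝ} (hp : 0 < p) (g : ℝ → ℂ) :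
    (∫⁻ x : ℝ, ENNReal.ofReal (|x| ^ p * ‖g x‖ ^ p)) ^ (1 / p) =
      eLpNorm (fun x : ℝ => (x : ℂ) * g x) (ENNReal.ofReal p) volume := by
  rw [eLpNorm_eq_lintegral_rpow_enorm_toReal (by simpa using hp) ENNReal.ofReal_ne_top,
    ENNReal.toReal_ofReal hp.le]
  congr 1
  refine lintegral_congr fun x => ?_
  rw [← Real.mul_rpow (abs_nonneg _) (norm_nonneg _), ← Real.norm_eq_abs, ← Complex.norm_real,
    ← norm_mul, ← ofReal_norm, ENNReal.ofReal_rpow_of_nonneg (norm_nonneg _) hp.le]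

theorem eLpNorm_mul_saftIntegral (hB : Λ.B ≠ 0) {p : ℝ} (hp : 0 < p) (f : ℝ → ℂ) :
    eLpNorm (fun ω : ℝ => (ω : ℂ) * saftIntegral Λ f ω) (ENNReal.ofReal p) volume =
      ENNReal.ofReal ((2 * Real.pi * |Λ.B|) ^ ((p + 2) / (2 * p))) *
        eLpNorm (fun ξ : ℝ => (ξ : ℂ) * 𝓕 (fun x => Λ.chirp x * f x) ξ)
          (ENNReal.ofReal p) volume := by
  have hpos : 0 < 2 * Real.pi * |Λ.B| := by positivity
  set c := 2 * Real.pi * |Λ.B| with hc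
  have hb : (2 * Real.pi * Λ.B)⁻¹ ≠ 0 := inv_ne_zero (by positivity)
  have habs : |2 * Real.pi * Λ.B| = c := by
    rw [abs_mul, abs_of_pos (by positivity : 0 < 2 * Real.pi)]
  have e1 : eLpNorm (fun ω : ℝ => (ω : ℂ) * saftIntegral Λ f ω) (ENNReal.ofReal p) volume =
      eLpNorm ((c ^ (1 / 2 : ℝ)) • fun ω : ℝ =>
        (fun ξ : ℝ => (ξ : ℂ) * 𝓕 (fun x => Λ.chirp x * f x) ξ) ((2 * Real.pi * Λ.B)⁻¹ * ω))
        (ENNReal.ofReal p) volume := by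
    refine eLpNorm_congr_norm_ae (Eventually.of_forall fun ω => ?_)
    rw [norm_mul, norm_saftIntegral hB, Pi.smul_apply, norm_smul, norm_mul, Complex.norm_real,
      Complex.norm_real, Real.norm_of_nonneg (by positivity : 0 ≤ c ^ (1 / 2 : ℝ)), norm_mul,
      norm_inv, Real.norm_eq_abs (2 * Real.pi * Λ.B), habs, ← hc]
    have : c ^ (-(1 / 2) : ℝ) = c ^ (1 / 2 : ℝ) * c⁻¹ := by
      rw [← Real.rpow_neg_one c, ← Real.rpow_add hpos]; norm_num
    rw [this]
    ring
  rw [e1, eLpNorm_const_smul, eLpNorm_comp_mul_left hb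
      (fun ξ : ℝ => (ξ : ℂ) * 𝓕 (fun x => Λ.chirp x * f x) ξ) ENNReal.ofReal_ne_top, inv_inv, habs,
    ENNReal.toReal_ofReal hp.le, ← mul_assoc, Real.enorm_of_nonneg (by positivity),
    ENNReal.ofReal_rpow_of_pos hpos, ← ENNReal.ofReal_mul (by positivity), ← Real.rpow_add hpos]
  congr 3
  field_simp

end AugmentedMatrix

open AugmentedMatrix in
theorem theorem4p1 (Λ : AugmentedMatrix) (hB : Λ.B ≠ 0) (f : Lp ℂ 2 (volume : Measure ℝ))
    (p : ℝ) (hp1 : 1 ≤ p) (hp2 : p ≤ 2) :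
    ENNReal.ofReal (|Λ.B| ^ ((p + 2) / (2 * p)) / 2) * eLpNorm f 2 volume ^ 2 ≤
      (∫⁻ x : ℝ, ENNReal.ofReal (|x| ^ p * ‖f x‖ ^ p)) ^ (1 / p) *
        (∫⁻ ω : ℝ, ENNReal.ofReal (|ω| ^ p * ‖saft Λ f ω‖ ^ p)) ^ (1 / p) := by
  have hp : 0 < p := by linarith
  have hp' : ENNReal.ofReal p ≠ 0 := by simpa using hp
  rw [lintegral_rpow_eq_eLpNorm hp, lintegral_rpow_eq_eLpNorm hp]
  have hmeas : ∀ g : Lp ℂ 2 (volume : Measure ℝ),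
      AEStronglyMeasurable (fun x : ℝ => (x : ℂ) * g x) volume := fun g =>
    Complex.continuous_ofReal.aestronglyMeasurable.mul (Lp.aestronglyMeasurable g)
  have hzero : ∀ g : Lp ℂ 2 (volume : Measure ℝ),
      eLpNorm (fun x : ℝ => (x : ℂ) * g x) (ENNReal.ofReal p) volume = 0 → g = 0 := by
    intro g hg
    rw [eLpNorm_eq_zero_iff (hmeas g) hp'] at hg
    refine (Lp.eq_zero_iff_ae_eq_zero).mpr ?_
    filter_upwards [hg, compl_mem_ae_iff.mpr (measure_singleton (0 : ℝ))] with x hx hx0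
    have hx0 : (x : ℂ) ≠ 0 := by exact_mod_cast hx0
    exact (mul_eq_zero.mp hx).resolve_left hx0
  by_cases hf0 : f = 0
  · have : eLpNorm f 2 volume = 0 := by
      rw [← Lp.enorm_def, hf0, enorm_zero]
    simp [this]
  set X := eLpNorm (fun x : ℝ => (x : ℂ) * f x) (ENNReal.ofReal p) volume with hX
  set Y := eLpNorm (fun ω : ℝ => (ω : ℂ) * saft Λ f ω) (ENNReal.ofReal p) volume with hY
  have hX0 : X ≠ 0 := fun h => hf0 (hzero f h)
  have hY0 : Y ≠ 0 := fun h => hf0 (eq_zero_of_saft_eq_zero hB f (hzero _ h))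
  by_cases hXt : X = ∞
  · rw [hXt, ENNReal.top_mul hY0]; exact le_top
  have hfi : Integrable f := integrable_of_memLp_two_of_memLp_mul hp1 hp2 (Lp.memLp f)
    ⟨hmeas f, lt_top_iff_ne_top.mpr hXt⟩
  set g : ℝ → ℂ := fun x => Λ.chirp x * f x with hg
  have key := eLpNorm_sq_le_mul_fourier hp1 hp2 (memLp_chirp_mul (Λ := Λ) (Lp.memLp f))
    (memLp_one_iff_integrable.mp (memLp_chirp_mul (Λ := Λ) (memLp_one_iff_integrable.mpr hfi)))
  have e1 : eLpNorm g 2 volume = eLpNorm f 2 volume :=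
    eLpNorm_congr_norm_ae (Eventually.of_forall fun x => by
      rw [hg, norm_mul, norm_chirp, one_mul])
  have e2 : eLpNorm (fun x : ℝ => (x : ℂ) * g x) (ENNReal.ofReal p) volume = X :=
    eLpNorm_congr_norm_ae (Eventually.of_forall fun x => by
      rw [hg, norm_mul, norm_mul, norm_mul, norm_chirp, one_mul])
  have e3 : Y = ENNReal.ofReal ((2 * Real.pi * |Λ.B|) ^ ((p + 2) / (2 * p))) *
      eLpNorm (fun ξ : ℝ => (ξ : ℂ) * 𝓕 g ξ) (ENNReal.ofReal p) volume := by
    rw [← eLpNorm_mul_saftIntegral hB hp]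
    refine eLpNorm_congr_ae ?_
    filter_upwards [saft_ae_eq_saftIntegral hB f hfi] with ω hω
    rw [hω]
  rw [e1, e2] at key
  set Z := eLpNorm (fun ξ : ℝ => (ξ : ℂ) * 𝓕 g ξ) (ENNReal.ofReal p) volume
  -- As `p ≤ 2`, the exponent `(p + 2) / (2 p)` is at least `1`, with equality at `p = 2`.
  have hconst : |Λ.B| ^ ((p + 2) / (2 * p)) / 2 * (4 * Real.pi) ≤
      (2 * Real.pi * |Λ.B|) ^ ((p + 2) / (2 * p)) := by
    rw [Real.mul_rpow (by positivity) (abs_nonneg _)]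
    have h2pi : 2 * Real.pi ≤ (2 * Real.pi) ^ ((p + 2) / (2 * p)) := by
      refine Real.self_le_rpow_of_one_le (by linarith [Real.pi_gt_three]) ?_
      rw [le_div_iff₀ (by positivity)]
      linarith
    have : 0 ≤ |Λ.B| ^ ((p + 2) / (2 * p)) := by positivity
    nlinarith
  calc ENNReal.ofReal (|Λ.B| ^ ((p + 2) / (2 * p)) / 2) * eLpNorm f 2 volume ^ 2
      ≤ ENNReal.ofReal (|Λ.B| ^ ((p + 2) / (2 * p)) / 2) *
        (ENNReal.ofReal (4 * Real.pi) * (X * Z)) := by gcongr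
    _ = ENNReal.ofReal (|Λ.B| ^ ((p + 2) / (2 * p)) / 2 * (4 * Real.pi)) * (X * Z) := by
      rw [← mul_assoc, ← ENNReal.ofReal_mul (by positivity)]
    _ ≤ ENNReal.ofReal ((2 * Real.pi * |Λ.B|) ^ ((p + 2) / (2 * p))) * (X * Z) := by gcongr
    _ = X * Y := by rw [e3]; ring
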